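/- An $n$-node interaction system with two actions per node consists of a state space $A=\{0,1\}^n$ and, for each node $i\in\{1,\dots,n\}$, a reaction function $f_i:A^+\to\{0,1\}$, where $A^+$ is the set of nonempty finite sequences of states (histories). A schedule is a function $\sigma$ assigning to every time $t\ge 1$ a set $\sigma(t)\subseteq\{1,\dots,n\}$ of activated nodes; it is fair if every node is activated infinitely often. Given a history $H=(a^0,\dots,a^{\ell-1})$ and a schedule $\sigma$, the $(H,\sigma)$-trajectory is the sequence $a^0,a^1,\dots$ extending $H$ with, for $t\ge\ell$, $a^t_i=f_i(a^0,\dots,a^{t-1})$ if $i\in\sigma(t)$ and $a^t_i=a^{t-1}_i$ otherwise. The system is convergent if, for every history $H$ and every fair schedule $\sigma$, the $(H,\sigma)$-trajectory is eventually constant. The function $f_i$ is historyless if $f_i(H)$ depends only on the last state of $H$, and self-independent if $f_i(H)$ does not depend on the actions of node $i$ in $H$. Consider deterministic communication protocols in which node $i$ is given its own reaction function $f_i$ as private input, the nodes take turns broadcasting bits (who speaks next is determined by the bits sent so far, and each bit is determined by these bits and the speaker's private input), and after finitely many bits the transcript determines the answer. Theorem. Determining whether an $n$-node system with two actions per node is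 convergent requires communicating $\Omega(2^n)$ bits, and this holds even if all reaction functions are historyless and self-independent. That is, there are a constant $c>0$ and an $N$ such that for every $n\ge N$: (1) every protocol that correctly determines, for all $n$-node systems with two actions per node, whether the system is convergent communicates at least $c\,2^n$ bits on some such system; (2) every protocol that correctly determines this for all such systems whose reaction functions are all historyless and self-independent communicates at least $c\,2^n$ bits on some system whose reaction functions are all historyless and self-independent. -/

import Mathlib

/-- A history over a set `S` of states: a nonempty finite sequence
`state 0, …, state last` of states. -/
structure History (S : Type) where
  /-- The index of the most recent state, so the history has length `last + 1`. -/
  last : ℕ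
  /-- The states, in chronological order. -/
  state : Fin (last + 1) → S

/-- The most recent state of a history. -/
def History.current {S : Type} (H : History S) : S := H.state (Fin.last H.last)

/-- The history formed by the states at times `0, …, t` of an infinite state sequence. -/
def History.upTo {S : Type} (a : ℕ → S) (t : ℕ) : History S where
  last := t
  state := fun k => a k

/-- An interaction system with `n` nodes: each node `i` has an action space `Action i` and a
deterministic reaction function from histories of states to its own actions. -/
structure InteractionSystem (n : ℕ) (Action : Fin n → Type) where
  /-- The reaction function of each node. -/
  react : (i : Fin n) → History ((j : Fin n) → Action j) → Action i

/-- A schedule assigns to each time step `t ≥ 1` the set of nodes activated at time `t`.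
The value at `t = 0` is never used. -/
abbrev Schedule (n : ℕ) : Type := ℕ → Set (Fin n)

/-- A schedule is fair if every node is activated at infinitely many (positive) times. -/
def Schedule.Fair {n : ℕ} (σ : Schedule n) : Prop :=
  ∀ i : Fin n, {t : ℕ | 0 < t ∧ i ∈ σ t}.Infinite

namespace InteractionSystem

variable {n : ℕ} {Action : Fin n → Type}

/-- The sequence `a` is the `(H, σ)`-trajectory of the system: it extends the initial history `H`,
and at every later time each activated node applies its reaction function to the history so far,
while each non-activated node repeats its previous action. -/
def IsTrajectory (F : InteractionSystem n Action) (H : History ((j : Fin n) → Action j))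
    (σ : Schedule n) (a : ℕ → (j : Fin n) → Action j) : Prop :=
  (∀ k : Fin (H.last + 1), a k = H.state k) ∧
  ∀ t : ℕ, H.last ≤ t → ∀ i : Fin n,
    (i ∈ σ (t + 1) → a (t + 1) i = F.react i (History.upTo a t)) ∧
    (i ∉ σ (t + 1) → a (t + 1) i = a t i)

/-- A system is convergent if every fair trajectory converges, that is, eventually remains at a
single state forever. -/
def Convergent (F : InteractionSystem n Action) : Prop :=
  ∀ (H : History ((j : Fin n) → Action j)) (σ : Schedule n), σ.Fair →
    ∀ a : ℕ → (j : Fin n) → Action j, F.IsTrajectory H σ a →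
      ∃ b : (j : Fin n) → Action j, ∃ T : ℕ, ∀ t : ℕ, T < t → a t = b

/-- All reaction functions are historyless: each depends only on the most recent state. -/
def Historyless (F : InteractionSystem n Action) : Prop :=
  ∀ i : Fin n, ∃ g : ((j : Fin n) → Action j) → Action i,
    ∀ H : History ((j : Fin n) → Action j), F.react i H = g H.current

/-- All reaction functions are self-independent: each factors through the history in which the
actions of the node itself are omitted. -/
def SelfIndependent (F : InteractionSystem n Action) : Prop :=
  ∀ i : Fin n, ∃ g : History ((j : {j : Fin n // j ≠ i}) → Action j) → Action i,
    ∀ H : History ((j : Fin n) → Action j),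
      F.react i H = g ⟨H.last, fun k j => H.state k j⟩

end InteractionSystem

/-- A deterministic communication protocol (on a shared blackboard) between `n` parties, party `i`
holding a private input from `Input i`. The protocol is a finite binary tree. A leaf announces the
answer. At an inner node the protocol specifies which party speaks; that party broadcasts one bit,
computed from its private input (and from the bits broadcast before, that is, from the position in
the tree), and this bit determines the subtree in which the protocol continues. -/
inductive Protocol (n : ℕ) (Input : Fin n → Type) : Type
  | answer (b : Bool) : Protocol n Input
  | speak (i : Fin n) (bit : Input i → Bool) (next : Bool → Protocol n Input) : Protocol n Input

namespace Protocol

variable {n : ℕ}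

/-- The answer of a protocol on given private inputs. -/
def output {Input : Fin n → Type} : Protocol n Input → ((i : Fin n) → Input i) → Bool
  | answer b, _ => b
  | speak i bit next, x => (next (bit (x i))).output x

/-- The number of bits communicated by a protocol on given private inputs. -/
def bits {Input : Fin n → Type} : Protocol n Input → ((i : Fin n) → Input i) → ℕ
  | answer _, _ => 0
  | speak i bit next, x => (next (bit (x i))).bits x + 1

end Protocol

/-- A communication protocol between the nodes of an interaction system, in which the private input
of node `i` is its reaction function. -/
abbrev NodeProtocol (n : ℕ) (Action : Fin n → Type) : Type :=
  Protocol n (fun i => History ((j : Fin n) → Action j) → Action i)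

/-- The protocol correctly determines, for every system of the class `C`, whether the system is
convergent. -/
def NodeProtocol.DeterminesConvergenceOn {n : ℕ} {Action : Fin n → Type}
    (P : NodeProtocol n Action) (C : Set (InteractionSystem n Action)) : Prop :=
  ∀ F ∈ C, P.output F.react = true ↔ F.Convergent

/-! Set disjointness is embedded in convergence. Nodes `1` and `2` hold sets `t` and `s` of
odd-weight vertices of a cube whose current vertex the remaining nodes store. With no collapse or
reset under way, each vertex node reacts by a parity rule that ignores its own action and fixes
exactly the odd-weight vertices. If some `v` lies in both sets, the system can load `v`, raise node
`2`, lower node `1` and reset, forever (`not_convergent_of_mem`). If the sets are disjoint, fairness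
forces nodes `0` and `1` to become `1` together, after which everything becomes `1`
(`convergent_of_disjoint`). The pairs (set, complement) over a `k`-cube form a fooling family of `2
^ 2 ^ k` convergent systems, any two of which mix into a nonconvergent one. Hence `2 ^ k` bits are
needed, with `n = k + 4`: three control nodes, `k` coordinates and a parity coordinate. -/

/-! ### The fooling set bound for blackboard protocols -/

/-- **Fooling set bound.** If a protocol gives the same answer on all inputs of a finite family, but
any two members of the family can be mixed into an input with a different answer, then a protocol
of cost at most `B` on the family forces the family to have at most `2 ^ B` members. -/
theorem Protocol.card_le_two_pow_of_fooling {n : ℕ} {Input : Fin n → Type} {ι : Type}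
    (X : ι → (i : Fin n) → Input i) (c : Bool) (P : Protocol n Input) :
    ∀ (B : ℕ) (S : Finset ι),
      (∀ s ∈ S, P.bits (X s) ≤ B) →
      (∀ s ∈ S, ∀ s' ∈ S, s ≠ s' → ∃ z : (i : Fin n) → Input i,
        (∀ i, z i = X s i ∨ z i = X s' i) ∧ P.output z ≠ c) →
      (∀ s ∈ S, P.output (X s) = c) → S.card ≤ 2 ^ B := by
  induction P with
  | answer b =>
    intro B S _ hmix hout
    refine le_trans (Finset.card_le_one.2 fun s hs s' hs' => ?_) Nat.one_le_two_pow
    by_contra hne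
    obtain ⟨z, -, hz⟩ := hmix s hs s' hs' hne
    exact hz (hout s hs)
  | speak i bit next ih =>
    intro B S hB hmix hout
    rcases S.eq_empty_or_nonempty with rfl | ⟨s₀, hs₀⟩
    · simp
    obtain ⟨B, rfl⟩ : ∃ B', B = B' + 1 := by
      have := hB s₀ hs₀
      simp only [Protocol.bits] at this
      exact ⟨B - 1, by omega⟩
    have key : ∀ b : Bool, (S.filter fun s => bit (X s i) = b).card ≤ 2 ^ B := by
      intro b
      refine ih b B _ ?_ ?_ ?_
      · intro s hs
        obtain ⟨hs, hb⟩ := Finset.mem_filter.1 hs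
        have := hB s hs
        simp only [Protocol.bits, hb] at this
        omega
      · intro s hs s' hs' hne
        obtain ⟨hs, hb⟩ := Finset.mem_filter.1 hs
        obtain ⟨hs', hb'⟩ := Finset.mem_filter.1 hs'
        obtain ⟨z, hz, hzc⟩ := hmix s hs s' hs' hne
        refine ⟨z, hz, ?_⟩
        -- The speaker's input in the mixture comes from one of two members that both send `b`, so
        -- the mixture follows the same branch.
        have hzb : bit (z i) = b := by
          rcases hz i with h | h <;> rw [h] <;> assumption
        simpa only [Protocol.output, hzb] using hzc
      · intro s hs
        obtain ⟨hs, hb⟩ := Finset.mem_filter.1 hs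
        simpa only [Protocol.output, hb] using hout s hs
    have hsplit := Finset.card_filter_add_card_filter_not (s := S) (fun s => bit (X s i) = true)
    have h1 := key true
    have h2 := key false
    simp only [Bool.not_eq_true] at hsplit
    rw [pow_succ]
    omega

/-! ### Historyless systems given by a map on states -/

namespace InteractionSystem

/-- The historyless system in which node `i` reacts to the current state by `g i`. -/
def ofMap {n : ℕ} (g : Fin n → (Fin n → Fin 2) → Fin 2) :
    InteractionSystem n (fun _ => Fin 2) :=
  ⟨fun i H => g i H.current⟩

theorem ofMap_historyless {n : ℕ} (g : Fin n → (Fin n → Fin 2) → Fin 2) :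
    (ofMap g).Historyless :=
  fun i => ⟨g i, fun _ => rfl⟩

theorem ofMap_selfIndependent {n : ℕ} (g : Fin n → (Fin n → Fin 2) → Fin 2)
    (hg : ∀ i a b, (∀ j, j ≠ i → a j = b j) → g i a = g i b) :
    (ofMap g).SelfIndependent := by
  intro i
  -- The filler `0` for the node's own action is harmless by `hg`.
  refine ⟨fun K => g i fun j => if h : j ≠ i then K.state (Fin.last K.last) ⟨j, h⟩ else 0, ?_⟩
  intro H
  refine hg i _ _ fun j hj => ?_
  simp [hj, History.current]

theorem current_upTo {S : Type} (a : ℕ → S) (t : ℕ) : (History.upTo a t).current = a t := by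
  simp [History.current, History.upTo]

end InteractionSystem

/-! ### The disjointness gadget

Node `0` triggers the collapse to the all-ones state, node `1` switches the reset mode on and off,
node `2` knows the set `s`, node `1` knows the set `t`, and the remaining `m` nodes hold a vertex
of the `m`-dimensional cube. -/

namespace DisjointnessGadget

open InteractionSystem

variable {m : ℕ}

/-- The vertex of the `m`-cube held by the nodes from `3` on. -/
def vertex (a : Fin (m + 3) → Fin 2) : Fin m → Fin 2 := fun j => a j.succ.succ.succ

/-- The state with prescribed actions of the three control nodes and prescribed vertex. -/
def mk (x y z : Fin 2) (v : Fin m → Fin 2) : Fin (m + 3) → Fin 2 :=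
  Fin.cons x (Fin.cons y (Fin.cons z v))

open Classical in
/-- The reactions of the gadget to the current state. -/
noncomputable def react (s t : Set (Fin m → Fin 2)) :
    Fin (m + 3) → (Fin (m + 3) → Fin 2) → Fin 2 :=
  Fin.cons (fun a => if a 1 = 0 ∧ a 2 = 0 ∧ vertex a = 0 then 0 else 1) <|
  Fin.cons (fun a => if a 0 = 0 ∧ a 2 = 1 ∧ vertex a ∈ t then 0 else 1) <|
  Fin.cons (fun a => if a 1 = 0 then 0 else if a 0 = 1 ∨ vertex a ∈ s then 1 else 0) <|
  fun j a => if a 1 = 0 then 0 else if a 0 = 1 then 1 else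
    1 + ∑ k ∈ Finset.univ.erase j, vertex a k

section react

variable (s t : Set (Fin m → Fin 2)) (a : Fin (m + 3) → Fin 2)

open Classical in
theorem react_zero :
    react s t 0 a = if a 1 = 0 ∧ a 2 = 0 ∧ vertex a = 0 then 0 else 1 := rfl

open Classical in
theorem react_one :
    react s t 1 a = if a 0 = 0 ∧ a 2 = 1 ∧ vertex a ∈ t then 0 else 1 := rfl

open Classical in
theorem react_two :
    react s t 2 a = if a 1 = 0 then 0 else if a 0 = 1 ∨ vertex a ∈ s then 1 else 0 := rfl

theorem react_vertex (j : Fin m) :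
    react s t j.succ.succ.succ a = if a 1 = 0 then 0 else if a 0 = 1 then 1 else
      1 + ∑ k ∈ Finset.univ.erase j, vertex a k := rfl

theorem forall_node {p : Fin (m + 3) → Prop} :
    (∀ i, p i) ↔ p 0 ∧ p 1 ∧ p 2 ∧ ∀ j : Fin m, p j.succ.succ.succ := by
  rw [Fin.forall_fin_succ, Fin.forall_fin_succ, Fin.forall_fin_succ]
  rfl

theorem zero_ne_two : (0 : Fin (m + 3)) ≠ 2 := fun h =>
  absurd (show (0 : ℕ) = 2 from congrArg Fin.val h) (by decide)

theorem one_ne_two : (1 : Fin (m + 3)) ≠ 2 := fun h =>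
  absurd (show (1 : ℕ) = 2 from congrArg Fin.val h) (by decide)

theorem succ_ne_zero (j : Fin m) : (j.succ.succ.succ : Fin (m + 3)) ≠ 0 :=
  Fin.succ_ne_zero _

theorem succ_ne_one (j : Fin m) : (j.succ.succ.succ : Fin (m + 3)) ≠ 1 := fun h =>
  absurd (show (j : ℕ) + 3 = (1 : ℕ) from congrArg Fin.val h) (by omega)

theorem succ_ne_two (j : Fin m) : (j.succ.succ.succ : Fin (m + 3)) ≠ 2 := fun h =>
  absurd (show (j : ℕ) + 3 = (2 : ℕ) from congrArg Fin.val h) (by omega)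

theorem react_congr (i : Fin (m + 3)) (a b : Fin (m + 3) → Fin 2)
    (h : ∀ j, j ≠ i → a j = b j) : react s t i a = react s t i b := by
  have hv : (∀ j : Fin m, j.succ.succ.succ ≠ i) → vertex a = vertex b := fun hj =>
    funext fun j => h _ (hj j)
  revert i
  rw [forall_node]
  refine ⟨fun h hv => ?_, fun h hv => ?_, fun h hv => ?_, fun j h hv => ?_⟩
  · rw [react_zero, react_zero, h 1 one_ne_zero, h 2 zero_ne_two.symm, hv succ_ne_zero]
  · rw [react_one, react_one, h 0 zero_ne_one, h 2 one_ne_two.symm, hv succ_ne_one]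
  · rw [react_two, react_two, h 0 zero_ne_two, h 1 one_ne_two, hv succ_ne_two]
  · rw [react_vertex, react_vertex, h 0 (succ_ne_zero j).symm, h 1 (succ_ne_one j).symm]
    have : ∑ k ∈ Finset.univ.erase j, vertex a k = ∑ k ∈ Finset.univ.erase j, vertex b k := by
      refine Finset.sum_congr rfl fun k hk => h _ ?_
      simpa using hk
    rw [this]

/-- While no reset or collapse is under way, vertices of odd weight are at rest. -/
theorem react_vertex_of_odd (h0 : a 0 = 0) (h1 : a 1 = 1) (hv : ∑ k, vertex a k = 1) (j : Fin m) :
    react s t j.succ.succ.succ a = vertex a j := by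
  rw [react_vertex, h0, h1]
  rw [← Finset.add_sum_erase _ _ (Finset.mem_univ j)] at hv
  simp only [one_ne_zero, zero_ne_one, if_false]
  generalize ∑ k ∈ Finset.univ.erase j, vertex a k = x at *
  generalize vertex a j = y at *
  revert x y
  decide

end react

/-! ### Convergence for disjoint sets -/

theorem eq_zero_or_one (x : Fin 2) : x = 0 ∨ x = 1 := by
  revert x; decide

/-- The successor of the state `a` when exactly the nodes in `A` are activated. -/
def IsStep (s t : Set (Fin m → Fin 2)) (A : Set (Fin (m + 3))) (a b : Fin (m + 3) → Fin 2) : Prop :=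
  ∀ i, (i ∈ A → b i = react s t i a) ∧ (i ∉ A → b i = a i)

theorem IsStep.or {s t : Set (Fin m → Fin 2)} {A : Set (Fin (m + 3))} {a b : Fin (m + 3) → Fin 2}
    (h : IsStep s t A a b) (i : Fin (m + 3)) : b i = react s t i a ∨ b i = a i := by
  by_cases hi : i ∈ A
  · exact .inl ((h i).1 hi)
  · exact .inr ((h i).2 hi)

/-- States from which only activations of the nodes `1` and `0` separate the collapse. -/
def Good (s : Set (Fin m → Fin 2)) (a : Fin (m + 3) → Fin 2) : Prop :=
  a 0 = 1 ∨ (a 2 = 0 ∧ vertex a = 0) ∨ (a 1 = 1 ∧ (a 2 = 1 → vertex a ∈ s))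

/-- States from which only an activation of node `0` separates the collapse. -/
def Better (s : Set (Fin m → Fin 2)) (a : Fin (m + 3) → Fin 2) : Prop :=
  a 1 = 1 ∧ (a 0 = 1 ∨ (a 2 = 1 → vertex a ∈ s))

section steps

variable {s t : Set (Fin m → Fin 2)} {A : Set (Fin (m + 3))} {a b : Fin (m + 3) → Fin 2}

theorem IsStep.collapse (h : IsStep s t A a b) (h0 : a 0 = 1) (h1 : a 1 = 1) :
    b 0 = 1 ∧ b 1 = 1 := by
  refine ⟨(h.or 0).elim (fun e => ?_) (fun e => e.trans h0),
    (h.or 1).elim (fun e => ?_) (fun e => e.trans h1)⟩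
  · rw [e, react_zero]; simp [h1]
  · rw [e, react_one]; simp [h0]

theorem react_collapse (h0 : a 0 = 1) (h1 : a 1 = 1) (i : Fin (m + 3)) : react s t i a = 1 := by
  revert i
  rw [forall_node]
  refine ⟨?_, ?_, ?_, fun j => ?_⟩
  · rw [react_zero]; simp [h1]
  · rw [react_one]; simp [h0]
  · rw [react_two]; simp [h0, h1]
  · rw [react_vertex]; simp [h0, h1]

theorem IsStep.vertex_eq_zero (h : IsStep s t A a b) (h1 : a 1 = 0) (hv : vertex a = 0) :
    vertex b = 0 := by
  funext j
  rcases h.or j.succ.succ.succ with e | e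
  · rw [react_vertex, if_pos h1] at e; exact e
  · exact e.trans (congrFun hv j)

theorem IsStep.two_eq_zero (h : IsStep s t A a b) (h1 : a 1 = 0) (h2 : a 2 = 0) : b 2 = 0 := by
  rcases h.or 2 with e | e
  · rw [react_two, if_pos h1] at e; exact e
  · exact e.trans h2

/-- While no reset or collapse is under way, node `2` is raised only on vertices in `s`. -/
theorem IsStep.mem_of_mem (hs : ∀ v ∈ s, ∑ k, v k = 1) (h : IsStep s t A a b) (h0 : a 0 = 0)
    (h1 : a 1 = 1) (ha : a 2 = 1 → vertex a ∈ s) (hb : b 2 = 1) : vertex b ∈ s := by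
  have hv : vertex a ∈ s := by
    rcases h.or 2 with e | e
    · by_contra hv
      rw [react_two] at e
      simp [h0, h1, hv, hb] at e
    · exact ha (e.symm.trans hb)
  have : vertex b = vertex a := by
    funext j
    rcases h.or j.succ.succ.succ with e | e
    · rw [react_vertex_of_odd s t a h0 h1 (hs _ hv)] at e; exact e
    · exact e
  rwa [this]

/-- Node `1` drops only on a vertex of `t` with node `2` raised and node `0` at `0`; there `Better`
puts the vertex in `s`, contradicting disjointness. -/
theorem IsStep.one_eq_one (hst : Disjoint s t) (h : IsStep s t A a b) (hb : Better s a) :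
    b 1 = 1 := by
  rcases h.or 1 with e | e
  · rw [e, react_one, if_neg]
    rintro ⟨h0, h2, hv⟩
    rcases hb.2 with h | h
    · simp [h0] at h
    · exact Set.disjoint_left.1 hst (h h2) hv
  · exact e.trans hb.1

theorem IsStep.better (hs : ∀ v ∈ s, ∑ k, v k = 1) (hst : Disjoint s t) (h : IsStep s t A a b)
    (hb : Better s a) : Better s b := by
  refine ⟨h.one_eq_one hst hb, ?_⟩
  rcases eq_zero_or_one (a 0) with h0 | h0
  · exact .inr (h.mem_of_mem hs h0 hb.1 (hb.2.resolve_left (by simp [h0])))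
  · exact .inl (h.collapse h0 hb.1).1

theorem IsStep.zero_eq_one (h : IsStep s t A a b) (h0 : a 0 = 1)
    (ha : ¬(a 1 = 0 ∧ a 2 = 0 ∧ vertex a = 0)) : b 0 = 1 := by
  rcases h.or 0 with e | e
  · rw [e, react_zero, if_neg ha]
  · exact e.trans h0

/-- With node `1` at `0`, a completed reset persists, and before completion node `0` cannot drop.
With node `1` at `1`, `Good` amounts to `Better`, which is invariant. -/
theorem IsStep.good (hs : ∀ v ∈ s, ∑ k, v k = 1) (hst : Disjoint s t) (h : IsStep s t A a b)
    (hg : Good s a) : Good s b := by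
  rcases eq_zero_or_one (a 1) with h1 | h1
  · by_cases hu : a 2 = 0 ∧ vertex a = 0
    · exact .inr (.inl ⟨h.two_eq_zero h1 hu.1, h.vertex_eq_zero h1 hu.2⟩)
    · refine .inl (h.zero_eq_one ?_ fun hh => hu hh.2)
      rcases hg with hg | hg | hg
      · exact hg
      · exact absurd hg hu
      · simp [h1] at hg
  · have hb : Better s a := by
      refine ⟨h1, ?_⟩
      rcases hg with hg | hg | hg
      · exact .inl hg
      · exact .inr fun h => by simp [hg.1] at h
      · exact .inr hg.2
    have := h.better hs hst hb
    rcases this.2 with h' | h'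
    · exact .inl h'
    · exact .inr (.inr ⟨this.1, h'⟩)

/-- Node `0` reacts by `0` only to a completed reset, which persists through the step. -/
theorem IsStep.good_of_mem (h : IsStep s t A a b) (hA : 0 ∈ A) : Good s b := by
  by_cases hu : a 1 = 0 ∧ a 2 = 0 ∧ vertex a = 0
  · exact .inr (.inl ⟨h.two_eq_zero hu.1 hu.2.1, h.vertex_eq_zero hu.1 hu.2.2⟩)
  · refine .inl ?_
    rw [(h 0).1 hA, react_zero, if_neg hu]

theorem IsStep.better_of_mem (hs : ∀ v ∈ s, ∑ k, v k = 1) (hst : Disjoint s t)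
    (h : IsStep s t A a b) (hg : Good s a) (hA : 1 ∈ A) : Better s b := by
  have hg' := h.good hs hst hg
  have h1 : b 1 = 1 := by
    rw [(h 1).1 hA, react_one, if_neg]
    rintro ⟨h0, h2, hv⟩
    rcases hg with hg | hg | hg
    · simp [h0] at hg
    · simp [h2] at hg
    · exact Set.disjoint_left.1 hst (hg.2 h2) hv
  refine ⟨h1, ?_⟩
  rcases hg' with hg | hg | hg
  · exact .inl hg
  · exact .inr fun h => by simp [hg.1] at h
  · exact .inr hg.2

theorem IsStep.collapse_of_mem (hst : Disjoint s t) (h : IsStep s t A a b) (hb : Better s a)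
    (hA : 0 ∈ A) : b 0 = 1 ∧ b 1 = 1 := by
  refine ⟨?_, h.one_eq_one hst hb⟩
  rw [(h 0).1 hA, react_zero, if_neg]
  simp [hb.1]

end steps

theorem forall_ge_of_step {p : (Fin (m + 3) → Fin 2) → Prop} {a : ℕ → Fin (m + 3) → Fin 2} {T : ℕ}
    (h : ∀ u, T ≤ u → p (a u) → p (a (u + 1))) (hT : p (a T)) : ∀ u, T ≤ u → p (a u) :=
  fun _ hu => Nat.le_induction hT (fun u hu => h u hu) _ hu

theorem _root_.Schedule.Fair.exists_ge {n : ℕ} {σ : Schedule n} (hσ : σ.Fair) (i : Fin n) (T : ℕ) :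
    ∃ u, T ≤ u ∧ i ∈ σ (u + 1) := by
  obtain ⟨u, ⟨h0, hu⟩, hT⟩ := (hσ i).exists_gt T
  exact ⟨u - 1, by omega, by rwa [Nat.sub_add_cancel h0]⟩

theorem convergent_of_disjoint {s t : Set (Fin m → Fin 2)} (hs : ∀ v ∈ s, ∑ k, v k = 1)
    (hst : Disjoint s t) : (ofMap (react s t)).Convergent := by
  intro H σ hσ a ha
  have step : ∀ u, H.last ≤ u → IsStep s t (σ (u + 1)) (a u) (a (u + 1)) := by
    intro u hu i
    have := ha.2 u hu i
    simpa only [ofMap, current_upTo] using this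
  obtain ⟨u₁, hu₁, hA₁⟩ := hσ.exists_ge 0 H.last
  have good := forall_ge_of_step (p := Good s)
    (fun u hu => (step u (by omega)).good hs hst) ((step u₁ hu₁).good_of_mem hA₁)
  obtain ⟨u₂, hu₂, hA₂⟩ := hσ.exists_ge 1 (u₁ + 1)
  have better := forall_ge_of_step (p := Better s)
    (fun u hu => (step u (by omega)).better hs hst)
    ((step u₂ (by omega)).better_of_mem hs hst (good u₂ hu₂) hA₂)
  obtain ⟨u₃, hu₃, hA₃⟩ := hσ.exists_ge 0 (u₂ + 1)
  have collapse := forall_ge_of_step (p := fun x => x 0 = 1 ∧ x 1 = 1)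
    (fun u hu hx => (step u (by omega)).collapse hx.1 hx.2)
    ((step u₃ (by omega)).collapse_of_mem hst (better u₃ hu₃) hA₃)
  -- After the collapse, node `i` takes the value `1` at time `w i + 1` at the latest and keeps it.
  choose w hw hwA using fun i => hσ.exists_ge i (u₃ + 1)
  refine ⟨fun _ => 1, Finset.univ.sup w, fun u hu => funext fun i => ?_⟩
  have hwi : w i + 1 ≤ u := (Finset.le_sup (Finset.mem_univ i)).trans_lt hu
  refine forall_ge_of_step (p := fun x => x i = 1) (fun k hk hx => ?_) ?_ u hwi
  · have hk' := hw i
    have hc := collapse k (by omega)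
    rcases (step k (by omega)).or i with e | e
    · exact e.trans (react_collapse hc.1 hc.2 i)
    · exact e.trans hx
  · have hk' := hw i
    have hc := collapse (w i) hk'
    exact ((step (w i) (by omega) i).1 (hwA i)).trans (react_collapse hc.1 hc.2 i)

/-! ### A periodic trajectory for intersecting sets -/

section mk

variable (x y z : Fin 2) (v : Fin m → Fin 2)

@[simp] theorem mk_zero : mk x y z v 0 = x := rfl

@[simp] theorem mk_one : mk x y z v 1 = y := rfl

@[simp] theorem mk_two : mk x y z v 2 = z := rfl

@[simp] theorem mk_vertex (j : Fin m) : mk x y z v j.succ.succ.succ = v j := rfl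

@[simp] theorem vertex_mk : vertex (mk x y z v) = v := rfl

end mk

/-- A periodic trajectory visiting the vertex `v`. -/
def orbit (v : Fin m → Fin 2) (u : ℕ) : Fin (m + 3) → Fin 2 :=
  match u % 5 with
  | 0 => mk 0 0 0 0
  | 1 => mk 0 1 0 0
  | 2 => mk 0 1 0 v
  | 3 => mk 0 1 1 v
  | _ => mk 0 0 1 v

/-- The schedule producing `orbit v`. -/
def orbitSchedule (v : Fin m → Fin 2) (u : ℕ) : Set (Fin (m + 3)) :=
  match u % 5 with
  | 0 => {i | i ≠ 0 ∧ i ≠ 1}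
  | 1 => Set.univ
  | 2 => {i | ∃ j : Fin m, i = j.succ.succ.succ ∧ v j = 1}
  | 3 => {2}
  | _ => {1}

theorem orbitSchedule_fair (v : Fin m → Fin 2) : Schedule.Fair (orbitSchedule v) := by
  intro i
  -- Phase `1` activates every node; node `0` stays at `0` there because the reset is complete.
  refine Set.infinite_of_forall_exists_gt fun T => ⟨5 * T + 1, ⟨by omega, ?_⟩, by omega⟩
  have : (5 * T + 1) % 5 = 1 := by omega
  simp [orbitSchedule, this]

theorem orbit_isStep {s t : Set (Fin m → Fin 2)} {v : Fin m → Fin 2} (hvs : v ∈ s) (hvt : v ∈ t)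
    (u : ℕ) : IsStep s t (orbitSchedule v (u + 1)) (orbit v u) (orbit v (u + 1)) := by
  have hne : ∀ j : Fin m, (j.succ.succ.succ : Fin (m + 3)) ≠ 0 ∧
      (j.succ.succ.succ : Fin (m + 3)) ≠ 1 ∧ (j.succ.succ.succ : Fin (m + 3)) ≠ 2 :=
    fun j => ⟨succ_ne_zero j, succ_ne_one j, succ_ne_two j⟩
  have h12 : (1 : Fin (m + 3)) ≠ 2 := one_ne_two
  have h02 : (0 : Fin (m + 3)) ≠ 2 := zero_ne_two
  have hu : u % 5 = 0 ∧ (u + 1) % 5 = 1 ∨ u % 5 = 1 ∧ (u + 1) % 5 = 2 ∨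
      u % 5 = 2 ∧ (u + 1) % 5 = 3 ∨ u % 5 = 3 ∧ (u + 1) % 5 = 4 ∨
      u % 5 = 4 ∧ (u + 1) % 5 = 0 := by omega
  rw [IsStep, forall_node]
  rcases hu with ⟨h, h'⟩ | ⟨h, h'⟩ | ⟨h, h'⟩ | ⟨h, h'⟩ | ⟨h, h'⟩ <;>
    simp only [orbit, orbitSchedule, h, h', react_zero, react_one, react_two, react_vertex]
  · simp
  · refine ⟨?_, ?_, ?_, fun j => ?_⟩
    · simp [fun j => (hne j).1.symm]
    · simp [fun j => (hne j).2.1.symm]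
    · simp [fun j => (hne j).2.2.symm]
    -- At the zero vertex every coordinate reacts by `1`, so activating the support of `v` loads `v`
    -- in one step.
    · rcases eq_zero_or_one (v j) with hj | hj <;> simp [hj]
  · simp [hne, hvs, h12, h02]
  · simp [hne, hvt, h12.symm]
  · simp [hne, h12.symm, h02.symm]

theorem not_convergent_of_mem {s t : Set (Fin m → Fin 2)} {v : Fin m → Fin 2} (hvs : v ∈ s)
    (hvt : v ∈ t) : ¬(ofMap (react s t)).Convergent := by
  intro hc
  obtain ⟨b, T, hT⟩ := hc ⟨0, fun _ => orbit v 0⟩ (orbitSchedule v) (orbitSchedule_fair v) (orbit v)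
    ⟨fun k => by rw [Fin.val_eq_zero k], fun u _ i => by
      simpa only [ofMap, current_upTo] using orbit_isStep hvs hvt u i⟩
  have h := (hT (5 * (T + 1)) (by omega)).trans (hT (5 * (T + 1) + 1) (by omega)).symm
  have h0 : (5 * (T + 1)) % 5 = 0 := by omega
  have h1 : (5 * (T + 1) + 1) % 5 = 1 := by omega
  simp only [orbit, h0, h1] at h
  simpa using congrFun h 1

/-! ### The fooling family and the lower bound -/

/-- The vertices of odd weight whose coordinates other than the first form a member of `s`. -/
def oddLift {k : ℕ} (s : Set (Fin k → Fin 2)) : Set (Fin (k + 1) → Fin 2) :=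
  {v | ∑ i, v i = 1 ∧ Fin.tail v ∈ s}

/-- The systems encoding disjoint instances: node `2` holds `s`, node `1` its complement. -/
noncomputable def system {k : ℕ} (s t : Finset (Fin k → Fin 2)) :
    InteractionSystem (k + 1 + 3) (fun _ => Fin 2) :=
  ofMap (react (oddLift (s : Set _)) (oddLift (t : Set _)ᶜ))

theorem system_convergent {k : ℕ} (s : Finset (Fin k → Fin 2)) : (system s s).Convergent :=
  convergent_of_disjoint (fun _ hv => hv.1) <|
    Set.disjoint_left.2 fun _ hv hv' => hv'.2 hv.2

theorem system_not_convergent {k : ℕ} {s t : Finset (Fin k → Fin 2)} {u : Fin k → Fin 2}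
    (hs : u ∈ s) (ht : u ∉ t) : ¬(system s t).Convergent := by
  -- The first coordinate is chosen to make the weight odd.
  have hsum : ∑ i, (Fin.cons (1 - ∑ i, u i) u : Fin (k + 1) → Fin 2) i = 1 := by
    rw [Fin.sum_cons, sub_add_cancel]
  exact not_convergent_of_mem (v := Fin.cons (1 - ∑ i, u i) u)
    ⟨hsum, by simpa using hs⟩ ⟨hsum, by simpa using ht⟩

theorem system_mem {k : ℕ} (s t : Finset (Fin k → Fin 2)) :
    (system s t).Historyless ∧ (system s t).SelfIndependent :=
  ⟨ofMap_historyless _, ofMap_selfIndependent _ (react_congr _ _)⟩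

/-- Only node `1` sees the second set, so this is a legal mixture of two members of the family. -/
theorem system_react_mix {k : ℕ} (s t : Finset (Fin k → Fin 2)) (i : Fin (k + 1 + 3)) :
    (system s t).react i = (system s s).react i ∨ (system s t).react i = (system t t).react i := by
  revert i
  rw [forall_node]
  exact ⟨.inl rfl, .inr rfl, .inl rfl, fun _ => .inl rfl⟩

/-- Some historyless self-independent system forces `2 ^ k` bits. -/
theorem exists_two_pow_le_bits {k : ℕ} (P : NodeProtocol (k + 1 + 3) (fun _ => Fin 2))
    (hP : P.DeterminesConvergenceOn {F | F.Historyless ∧ F.SelfIndependent}) :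
    ∃ F : InteractionSystem (k + 1 + 3) (fun _ => Fin 2),
      F.Historyless ∧ F.SelfIndependent ∧ 2 ^ k ≤ P.bits F.react := by
  by_contra! hlt
  have hpos : 0 < 2 ^ k := by positivity
  have hcard := Protocol.card_le_two_pow_of_fooling
    (fun s : Finset (Fin k → Fin 2) => (system s s).react) true P (2 ^ k - 1) Finset.univ
    (fun s _ => Nat.le_sub_one_of_lt (hlt _ (system_mem s s).1 (system_mem s s).2))
    (fun s _ s' _ hne => by
      have hout : ∀ {x y : Finset (Fin k → Fin 2)} {u}, u ∈ x → u ∉ y →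
          P.output (system x y).react ≠ true := fun hx hy =>
        (hP _ (system_mem _ _)).not.2 (system_not_convergent hx hy)
      obtain ⟨u, hu⟩ : ∃ u, ¬(u ∈ s ↔ u ∈ s') := by
        by_contra! h
        exact hne (Finset.ext h)
      by_cases hs : u ∈ s
      · exact ⟨_, system_react_mix s s', hout hs fun h => hu (iff_of_true hs h)⟩
      · exact ⟨_, fun i => (system_react_mix s' s i).symm,
          hout (by_contra fun h => hu (iff_of_false hs h)) hs⟩)
    (fun s _ => (hP _ (system_mem s s)).2 (system_convergent s))
  rw [Finset.card_univ, Fintype.card_finset, Fintype.card_fun, Fintype.card_fin,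
    Fintype.card_fin] at hcard
  have := (Nat.pow_le_pow_iff_right (by norm_num : 1 < 2)).1 hcard
  omega

end DisjointnessGadget

/-- Determining whether an `n`-node system with two actions per node is convergent requires
`Ω(2 ^ n)` bits of communication in the worst case, over all systems and also over the systems
whose reaction functions are all historyless and self-independent. -/
theorem mainTheorem5 :
    ∃ c : ℝ, 0 < c ∧ ∃ N : ℕ, ∀ n : ℕ, N ≤ n →
      (∀ P : NodeProtocol n (fun _ => Fin 2),
        NodeProtocol.DeterminesConvergenceOn P Set.univ →
          ∃ F : InteractionSystem n (fun _ => Fin 2),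
            c * (2 : ℝ) ^ n ≤ (P.bits F.react : ℝ)) ∧
      (∀ P : NodeProtocol n (fun _ => Fin 2),
        NodeProtocol.DeterminesConvergenceOn P {F | F.Historyless ∧ F.SelfIndependent} →
          ∃ F : InteractionSystem n (fun _ => Fin 2), F.Historyless ∧ F.SelfIndependent ∧
            c * (2 : ℝ) ^ n ≤ (P.bits F.react : ℝ)) := by
  refine ⟨1 / 16, by norm_num, 4, fun n hn => ?_⟩
  obtain ⟨k, rfl⟩ : ∃ k, n = k + 1 + 3 := ⟨n - 4, by omega⟩
  have hpow : 1 / 16 * (2 : ℝ) ^ (k + 1 + 3) = ((2 ^ k : ℕ) : ℝ) := by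
    push_cast
    ring
  have key : ∀ P : NodeProtocol (k + 1 + 3) (fun _ => Fin 2),
      P.DeterminesConvergenceOn {F | F.Historyless ∧ F.SelfIndependent} →
        ∃ F : InteractionSystem (k + 1 + 3) (fun _ => Fin 2), F.Historyless ∧ F.SelfIndependent ∧
          1 / 16 * (2 : ℝ) ^ (k + 1 + 3) ≤ (P.bits F.react : ℝ) := by
    intro P hP
    obtain ⟨F, hF, hF', hbits⟩ := DisjointnessGadget.exists_two_pow_le_bits P hP
    exact ⟨F, hF, hF', hpow.trans_le (Nat.cast_le.2 hbits)⟩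
  refine ⟨fun P hP => ?_, key⟩
  obtain ⟨F, -, -, hbits⟩ := key P fun F _ => hP F (Set.mem_univ F)
  exact ⟨F, hbits⟩
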